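/- A group $G$ is called sofic if it is isomorphic to a subgroup of a metric ultraproduct $\prod_{\alpha\in A}(S_{n(\alpha)},d_{\mathrm{hamm}})/\mathcal U$ of finite symmetric groups equipped with the normalized Hamming metric, for some set $A$, ultrafilter $\mathcal U$ on $A$ and map $n:A\to\mathbb N$. It is called minimal non-sofic if it is not sofic but every proper subgroup of it is sofic. **Theorem.** Let $G$ be a minimal non-sofic group. Then $G$ has no proper non-abelian simple normal subgroup $N$ whose outer automorphism group $\operatorname{Out}(N)=\operatorname{Aut}(N)/\operatorname{Inn}(N)$ is amenable (as a discrete group). -/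

import Mathlib

open Filter Topology

/-- The normalized Hamming distance on the symmetric group `S_n`: the proportion of points
at which the two permutations differ. (For `n = 0` the group is trivial and the value is `0`.) -/
noncomputable def normHamming {n : ℕ} (σ τ : Equiv.Perm (Fin n)) : ℝ :=
  (hammingDist (⇑σ) (⇑τ) : ℝ) / n

theorem normHamming_nonneg {n : ℕ} (σ τ : Equiv.Perm (Fin n)) : 0 ≤ normHamming σ τ := by
  unfold normHamming; positivity

theorem normHamming_self {n : ℕ} (σ : Equiv.Perm (Fin n)) : normHamming σ σ = 0 := by
  simp [normHamming]

theorem normHamming_comm {n : ℕ} (σ τ : Equiv.Perm (Fin n)) :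
    normHamming σ τ = normHamming τ σ := by
  simp [normHamming, hammingDist_comm]

theorem normHamming_triangle {n : ℕ} (σ τ ρ : Equiv.Perm (Fin n)) :
    normHamming σ ρ ≤ normHamming σ τ + normHamming τ ρ := by
  unfold normHamming
  rw [← add_div]
  have h := hammingDist_triangle (⇑σ) (⇑τ) (⇑ρ)
  gcongr
  exact_mod_cast h

theorem normHamming_mul_left {n : ℕ} (ρ σ τ : Equiv.Perm (Fin n)) :
    normHamming (ρ * σ) (ρ * τ) = normHamming σ τ := by
  simp [normHamming, hammingDist]

theorem normHamming_mul_right {n : ℕ} (ρ σ τ : Equiv.Perm (Fin n)) :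
    normHamming (σ * ρ) (τ * ρ) = normHamming σ τ := by
  unfold normHamming hammingDist
  congr 2
  exact Finset.card_equiv ρ (fun i => by
    rw [Finset.mem_filter, Finset.mem_filter]
    exact and_congr (by simp) Iff.rfl)

/-- The elements of `∏ α, S_{n(α)}` at distance zero from the identity along the ultrafilter `U`:
those `σ` for which the limit along `U` of the normalized Hamming distances `d(σ_α, 1)` is `0`. -/
def hammingNull {A : Type*} (U : Ultrafilter A) (n : A → ℕ) :
    Subgroup (∀ α, Equiv.Perm (Fin (n α))) where
  carrier := {σ | Tendsto (fun α => normHamming (σ α) 1) (U : Filter A) (𝓝 0)}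
  one_mem' := by simp [normHamming_self]
  mul_mem' := by
    intro σ τ hσ hτ
    have h := Tendsto.add hσ hτ
    rw [add_zero] at h
    refine squeeze_zero (fun α => normHamming_nonneg _ _) (fun α => ?_) h
    calc normHamming ((σ * τ) α) 1
        ≤ normHamming (σ α * τ α) (1 * τ α) + normHamming (1 * τ α) 1 :=
          normHamming_triangle _ _ _
      _ = normHamming (σ α) 1 + normHamming (τ α) 1 := by rw [normHamming_mul_right, one_mul]
  inv_mem' := by
    intro σ hσ
    refine hσ.congr (fun α => ?_)
    rw [Pi.inv_apply, ← normHamming_mul_left (σ α) (σ α)⁻¹ 1, mul_inv_cancel, mul_one,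
      normHamming_comm]

instance hammingNull_normal {A : Type*} (U : Ultrafilter A) (n : A → ℕ) :
    (hammingNull U n).Normal where
  conj_mem := by
    intro σ hσ ρ
    refine Tendsto.congr (fun α => ?_) hσ
    change normHamming (σ α) 1 = normHamming (ρ α * σ α * (ρ α)⁻¹) 1
    rw [← normHamming_mul_right (ρ α) (ρ α * σ α * (ρ α)⁻¹) 1, inv_mul_cancel_right, one_mul]
    conv_rhs => rw [← mul_one (ρ α)]
    rw [mul_assoc, one_mul, normHamming_mul_left]

/-- The metric ultraproduct of the symmetric groups `S_{n(α)}` with their normalized Hamming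
metrics along the ultrafilter `U`. -/
abbrev HammingUltraproduct {A : Type*} (U : Ultrafilter A) (n : A → ℕ) : Type _ :=
  (∀ α, Equiv.Perm (Fin (n α))) ⧸ hammingNull U n

/-- A group is sofic if it is isomorphic to a subgroup of a metric ultraproduct of finite
symmetric groups equipped with the normalized Hamming metric. (An index set in the universe of `G`
is no restriction, since `Finset G × ℕ` is always large enough.) -/
def IsSofic.{u} (G : Type u) [Group G] : Prop :=
  ∃ (A : Type u) (U : Ultrafilter A) (n : A → ℕ) (φ : G →* HammingUltraproduct U n),
    Function.Injective φ

/-- A group is minimal non-sofic if it is not sofic but all its proper subgroups are. -/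
def IsMinimalNonSofic (G : Type*) [Group G] : Prop :=
  ¬ IsSofic G ∧ ∀ H : Subgroup G, H ≠ ⊤ → IsSofic H

open scoped Classical Pointwise in
/-- Amenability of a discrete group (Følner): for every finite `S ⊆ G` and `ε > 0` there is a
nonempty finite `F ⊆ G` with `|sF ∆ F| ≤ ε |F|` for all `s ∈ S`. -/
def IsAmenable (G : Type*) [Group G] : Prop :=
  ∀ (S : Finset G) (ε : ℝ), 0 < ε → ∃ F : Finset G, F.Nonempty ∧
    ∀ s ∈ S, ((symmDiff (s • F) F).card : ℝ) ≤ ε * F.card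

/-- The group `Inn(N)` of inner automorphisms. -/
abbrev InnerAut (N : Type*) [Group N] : Subgroup (MulAut N) :=
  (MulAut.conj : N →* MulAut N).range

instance innerAut_normal (N : Type*) [Group N] : (InnerAut N).Normal where
  conj_mem := by
    rintro _ ⟨x, rfl⟩ f
    refine ⟨f x, ?_⟩
    ext y
    simp

/-- The outer automorphism group `Out(N) = Aut(N) / Inn(N)`. -/
abbrev OuterAut (N : Type*) [Group N] : Type _ := MulAut N ⧸ InnerAut N

/-! Conjugation gives a homomorphism `π` from `G` to Out(N), and its kernel decides the matter. If
the kernel is proper, it is sofic by minimality, and an extension of a sofic kernel by amenable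
image is sofic (`HasSoficApproximations.of_ker`). If the kernel is `G`, every element acts on the
centreless group `N` by an inner automorphism, so `G` is the product of `N` and its centralizer.
Both are proper, hence sofic, and products of sofic groups are sofic
(`HasSoficApproximations.prod`). Either way `G` would be sofic. Both closure properties are proved
for finitary approximations, which are equivalent to ultraproduct embeddings. -/

/-- Finitary soficity: every finite subset of `G` admits almost multiplicative maps to finite
symmetric groups under which its nontrivial elements have almost no fixed points. -/
def HasSoficApproximations (G : Type*) [Group G] : Prop :=
  ∀ (F : Finset G) (ε : ℝ), 0 < ε → ∃ (n : ℕ) (φ : G → Equiv.Perm (Fin n)), 0 < n ∧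
    (∀ g ∈ F, ∀ h ∈ F, ({x | φ (g * h) x ≠ φ g (φ h x)}.ncard : ℝ) ≤ ε * n) ∧
    ∀ g ∈ F, g ≠ 1 → ({x | φ g x = x}.ncard : ℝ) ≤ ε * n

/-! ### Finitary approximations versus ultraproduct embeddings -/

theorem normHamming_eq_ncard {n : ℕ} (σ τ : Equiv.Perm (Fin n)) :
    normHamming σ τ = ({x | σ x ≠ τ x}.ncard : ℝ) / n := by
  unfold normHamming hammingDist
  rw [Set.ncard_eq_toFinset_card']
  congr 3
  ext; simp

theorem ncard_le_mul_of_normHamming_le {n : ℕ} {σ τ : Equiv.Perm (Fin n)} {ε : ℝ}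
    (h : normHamming σ τ ≤ ε) : ({x | σ x ≠ τ x}.ncard : ℝ) ≤ ε * n := by
  rcases Nat.eq_zero_or_pos n with rfl | hn
  · have : {x : Fin 0 | σ x ≠ τ x} = ∅ := by ext x; exact x.elim0
    simp [this]
  · rw [normHamming_eq_ncard, div_le_iff₀ (by exact_mod_cast hn)] at h
    exact h

theorem normHamming_one_add_fixed {n : ℕ} (hn : 0 < n) (σ : Equiv.Perm (Fin n)) :
    normHamming σ 1 + ({x | σ x = x}.ncard : ℝ) / n = 1 := by
  have h := Set.ncard_add_ncard_compl {x | σ x = x}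
  have h0 : (n : ℝ) ≠ 0 := by positivity
  have hc : {x | σ x = x}ᶜ = {x | σ x ≠ (1 : Equiv.Perm (Fin n)) x} := by ext; simp
  rw [hc, Nat.card_eq_fintype_card, Fintype.card_fin] at h
  rw [normHamming_eq_ncard, ← add_div, div_eq_one_iff_eq h0, add_comm]
  exact_mod_cast h

/-- Approximations by permutations of any finite types suffice. -/
theorem HasSoficApproximations.of_fintype.{u, v} {G : Type u} [Group G]
    (H : ∀ (F : Finset G) (ε : ℝ), 0 < ε →
      ∃ (X : Type v) (_ : Fintype X) (φ : G → Equiv.Perm X), 0 < Nat.card X ∧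
        (∀ g ∈ F, ∀ h ∈ F, ({x | φ (g * h) x ≠ φ g (φ h x)}.ncard : ℝ) ≤ ε * Nat.card X) ∧
        ∀ g ∈ F, g ≠ 1 → ({x | φ g x = x}.ncard : ℝ) ≤ ε * Nat.card X) :
    HasSoficApproximations G := by
  intro F ε hε
  obtain ⟨X, _, φ, hX, h1, h2⟩ := H F ε hε
  let e := Finite.equivFin X
  refine ⟨Nat.card X, fun g => e.permCongr (φ g), hX, fun g hg h hh => ?_, fun g hg hg1 => ?_⟩
  · refine le_trans (le_of_eq ?_) (h1 g hg h hh)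
    rw [← Set.ncard_image_of_injective _ e.injective]
    congr 2
    ext x
    simp [← Equiv.symm_apply_eq, Set.mem_image_equiv]
  · refine le_trans (le_of_eq ?_) (h2 g hg hg1)
    rw [← Set.ncard_image_of_injective _ e.injective]
    congr 2
    ext x
    simp [Equiv.eq_symm_apply, Set.mem_image_equiv]

theorem HasSoficApproximations.isSofic.{u} {G : Type u} [Group G]
    (H : HasSoficApproximations G) : IsSofic G := by
  classical
  have hpos : ∀ a : Finset G × ℕ, (0 : ℝ) < 1 / (a.2 + 1) := fun a => by positivity
  choose n φ hn h1 h2 using fun a : Finset G × ℕ => H a.1 _ (hpos a)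
  -- Along `U` every fixed element eventually lies in the finite set, and the error tends to zero.
  let U : Ultrafilter (Finset G × ℕ) := Ultrafilter.of atTop
  have hU : (U : Filter (Finset G × ℕ)) ≤ atTop := Ultrafilter.of_le _
  have hmem (g : G) : ∀ᶠ a : Finset G × ℕ in U, g ∈ a.1 := by
    refine hU ((eventually_ge_atTop (({g} : Finset G), 0)).mono fun a ha => ?_)
    exact ha.1 (Finset.mem_singleton_self g)
  have hlim : Tendsto (fun a : Finset G × ℕ => (1 : ℝ) / (a.2 + 1)) U (𝓝 0) :=
    (tendsto_one_div_add_atTop_nhds_zero_nat.comp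
      (tendsto_snd.comp (prod_atTop_atTop_eq (α := Finset G) (β := ℕ)).symm.le)).mono_left hU
  refine ⟨Finset G × ℕ, U, n, MonoidHom.mk' (fun g => QuotientGroup.mk fun a => φ a g) ?_, ?_⟩
  · intro g h
    rw [← QuotientGroup.mk_mul, QuotientGroup.eq]
    refine squeeze_zero' (.of_forall fun a => normHamming_nonneg _ _) ?_ hlim
    filter_upwards [hmem g, hmem h] with a hg hh
    have := h1 a g hg h hh
    rw [← normHamming_mul_left (φ a (g * h))]
    simp only [Pi.mul_apply, Pi.inv_apply, mul_inv_cancel_left, mul_one]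
    rw [normHamming_comm, normHamming_eq_ncard,
      div_le_iff₀ (by exact_mod_cast hn a)]
    exact this
  · rw [injective_iff_map_eq_one]
    intro g hg
    by_contra hg1
    have hg0 : Tendsto (fun a => normHamming (φ a g) 1) U (𝓝 0) :=
      (QuotientGroup.eq_one_iff (N := hammingNull U n) fun a => φ a g).mp hg
    -- The proportions of moved and fixed points sum to 1, yet both would tend to 0.
    have h0 : (1 : ℝ) ≤ 0 + 0 := by
      refine ge_of_tendsto (hg0.add hlim) ?_
      filter_upwards [hmem g] with a ha
      refine (normHamming_one_add_fixed (hn a) (φ a g)).symm.trans_le (add_le_add_right ?_ _)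
      rw [div_le_iff₀ (by exact_mod_cast hn a)]
      exact h2 a g ha hg1
    norm_num at h0

theorem ncard_setOf_forall_mem {X : Type*} [Finite X] (k : ℕ) (S : Set X) :
    {x : Fin k → X | ∀ i, x i ∈ S}.ncard = S.ncard ^ k := by
  have e : {x : Fin k → X | ∀ i, x i ∈ S} ≃ (Fin k → S) := Equiv.subtypePiEquivPi
  rw [← Nat.card_coe_set_eq, Nat.card_congr e, Nat.card_fun, Nat.card_coe_set_eq,
    Nat.card_eq_fintype_card, Fintype.card_fin]

theorem ncard_setOf_exists_mem_le {X : Type*} [Finite X] (k : ℕ) (S : Set X) {ε : ℝ}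
    (h : (S.ncard : ℝ) ≤ ε * Nat.card X) :
    ({x : Fin k → X | ∃ i, x i ∈ S}.ncard : ℝ) ≤ k * ε * (Nat.card X : ℝ) ^ k := by
  have h1 := Set.ncard_add_ncard_compl {x : Fin k → X | ∀ i, x i ∈ Sᶜ}
  have hc : {x : Fin k → X | ∀ i, x i ∈ Sᶜ}ᶜ = {x | ∃ i, x i ∈ S} := by ext; simp
  rw [hc, ncard_setOf_forall_mem, Nat.card_fun, Nat.card_eq_fintype_card (α := Fin k),
    Fintype.card_fin] at h1
  have h2 := Set.ncard_add_ncard_compl S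
  rcases Nat.eq_zero_or_pos (Nat.card X) with h0 | h0
  · have hS : S.ncard = 0 := by omega
    have hS' : S = ∅ := (Set.ncard_eq_zero).mp hS
    subst hS'
    simp [h0]
    -- The sign of `ε` is unknown, but `k * 0 ^ k` vanishes for every `k`.
    rcases k with _ | k <;> simp
  · have hX : (0 : ℝ) < Nat.card X := by exact_mod_cast h0
    have h2' : (S.ncard : ℝ) + (Sᶜ.ncard : ℝ) = Nat.card X := by exact_mod_cast h2
    have h4 : (Sᶜ.ncard : ℝ) ^ k + ({x : Fin k → X | ∃ i, x i ∈ S}.ncard : ℝ) =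
        (Nat.card X : ℝ) ^ k := by exact_mod_cast h1
    set m : ℝ := (Nat.card X : ℝ)
    set s : ℝ := (S.ncard : ℝ)
    have h3 : (Sᶜ.ncard : ℝ) = m * (1 + -(s / m)) := by
      field_simp
      linarith
    have hs : s / m ≤ 1 := by
      rw [div_le_one hX]
      have : (0 : ℝ) ≤ (Sᶜ.ncard : ℝ) := by positivity
      linarith
    have h5 := one_add_mul_le_pow (a := -(s / m)) (by linarith) k
    have h6 : s / m ≤ ε := by rwa [div_le_iff₀ hX]
    have h7 : (Sᶜ.ncard : ℝ) ^ k ≥ m ^ k * (1 - k * ε) := by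
      rw [h3, mul_pow]
      gcongr
      refine le_trans ?_ h5
      have : (k : ℝ) * (s / m) ≤ k * ε := by gcongr
      linarith
    linarith

/-- Amplification: an embedding only keeps nontrivial elements a positive distance from 1. Acting
diagonally on `k`-tuples raises the proportion of fixed points to its `k`-th power, while
multiplicative errors grow at most by the factor `k`. -/
theorem IsSofic.hasSoficApproximations {G : Type*} [Group G] (H : IsSofic G) :
    HasSoficApproximations G := by
  obtain ⟨A, U, n, φ, hφ⟩ := H
  choose f hf using fun g : G => QuotientGroup.mk_surjective (φ g)
  have hmul (g h : G) :
      Tendsto (fun a => normHamming (f (g * h) a) (f g a * f h a)) U (𝓝 0) := by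
    have h1 : (QuotientGroup.mk (f (g * h)) : HammingUltraproduct U n) =
        QuotientGroup.mk (f g * f h) := by
      rw [QuotientGroup.mk_mul, hf, hf, hf, map_mul]
    rw [QuotientGroup.eq] at h1
    refine Tendsto.congr (fun a => ?_) h1
    rw [← normHamming_mul_left (f (g * h) a)]
    simp only [Pi.mul_apply, Pi.inv_apply, mul_inv_cancel_left, mul_one]
    rw [normHamming_comm]
  -- Along an ultrafilter, a bound `δ` that does not hold eventually fails eventually; if all `δ`
  -- failed, `φ g` would be trivial.
  have hne (g : G) (hg : g ≠ 1) : ∃ δ > 0, ∀ᶠ a in U, δ ≤ normHamming (f g a) 1 := by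
    by_contra! hcon
    refine hg ((injective_iff_map_eq_one φ).mp hφ g ?_)
    rw [← hf, QuotientGroup.eq_one_iff]
    change Tendsto (fun α => normHamming (f g α) 1) U (𝓝 0)
    rw [Metric.tendsto_nhds]
    intro δ hδ
    filter_upwards [hcon δ hδ] with a ha
    rw [Real.dist_0_eq_abs, abs_of_nonneg (normHamming_nonneg _ _)]
    exact ha
  refine HasSoficApproximations.of_fintype fun F ε hε => ?_
  by_cases htriv : ∀ g ∈ F, g = 1
  · refine ⟨Unit, inferInstance, fun _ => 1, by simp, fun g _ h _ => ?_,
      fun g hg hg1 => absurd (htriv g hg) hg1⟩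
    simp [hε.le]
  push Not at htriv
  obtain ⟨g₀, hg₀, hg₀1⟩ := htriv
  have hδ : ∃ δ > 0, δ ≤ 1 ∧ ∀ᶠ a in U, ∀ g ∈ F, g ≠ 1 → δ ≤ normHamming (f g a) 1 := by
    classical
    clear hg₀
    induction F using Finset.induction_on with
    | empty => exact ⟨1, one_pos, le_rfl, by simp⟩
    | insert g F _ ih =>
      obtain ⟨δ, hδ, hδ1, h⟩ := ih
      by_cases hg : g = 1
      · refine ⟨δ, hδ, hδ1, h.mono fun a ha => ?_⟩
        simpa [hg] using ha
      · obtain ⟨δ', hδ', h'⟩ := hne g hg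
        refine ⟨min δ δ', lt_min hδ hδ', min_le_of_left_le hδ1, ?_⟩
        filter_upwards [h, h'] with a ha ha'
        intro x hx hx1
        rcases Finset.mem_insert.mp hx with rfl | hx
        · exact min_le_of_right_le ha'
        · exact min_le_of_left_le (ha x hx hx1)
  obtain ⟨δ, hδ, hδ1, hsep⟩ := hδ
  obtain ⟨k, hk⟩ := exists_pow_lt_of_lt_one hε (by linarith : 1 - δ < 1)
  -- Over `k` coordinates this totals at most `ε`; the `+ 1` covers `k = 0`.
  have hη : (0 : ℝ) < ε / (k + 1) := by positivity
  have happrox : ∀ᶠ a in U, ∀ g ∈ F, ∀ h ∈ F,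
      normHamming (f (g * h) a) (f g a * f h a) ≤ ε / (k + 1) := by
    refine (Filter.eventually_all_finset F).mpr fun g _ =>
      (Filter.eventually_all_finset F).mpr fun h _ => ?_
    exact (hmul g h).eventually_le_const hη
  obtain ⟨a, ha, hb⟩ := (hsep.and happrox).exists
  -- On the empty set all distances are 0, contradicting the separation of `g₀`.
  have hna : 0 < n a := by
    by_contra h0
    have h0 : n a = 0 := by omega
    have := ha g₀ hg₀ hg₀1
    simp only [normHamming, h0, Nat.cast_zero, div_zero] at this
    linarith
  have hcard : (Nat.card (Fin k → Fin (n a)) : ℝ) = (n a : ℝ) ^ k := by simp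
  refine ⟨Fin k → Fin (n a), inferInstance, fun g => Equiv.piCongrRight fun _ => f g a, ?_,
    fun g hg h hh => ?_, fun g hg hg1 => ?_⟩
  · rw [← Nat.cast_pos (α := ℝ), hcard]
    positivity
  · have := ncard_setOf_exists_mem_le k
      {y : Fin (n a) | f (g * h) a y ≠ (f g a * f h a) y} (ε := ε / (k + 1))
      (by simpa using ncard_le_mul_of_normHamming_le (hb g hg h hh))
    rw [hcard]
    refine le_trans (le_of_eq ?_) (this.trans ?_)
    · congr 2
      ext x
      simp [funext_iff]
    · rw [Nat.card_eq_fintype_card, Fintype.card_fin]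
      gcongr
      rw [mul_div_assoc', div_le_iff₀ (by positivity)]
      nlinarith
  · have h1 := normHamming_one_add_fixed hna (f g a)
    have h2 := ha g hg hg1
    have h3 : {x : Fin k → Fin (n a) | (Equiv.piCongrRight fun _ => f g a) x = x} =
        {x | ∀ i, x i ∈ {y | f g a y = y}} := by
      ext x
      simp [funext_iff]
    rw [hcard, h3, ncard_setOf_forall_mem, Nat.cast_pow]
    have h4 : ({y | f g a y = y}.ncard : ℝ) ≤ (1 - δ) * n a := by
      rw [← div_le_iff₀ (by exact_mod_cast hna)]
      linarith
    calc ({y | f g a y = y}.ncard : ℝ) ^ k ≤ ((1 - δ) * n a) ^ k := by gcongr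
      _ = (1 - δ) ^ k * (n a : ℝ) ^ k := mul_pow _ _ _
      _ ≤ _ := by gcongr

theorem IsSofic.of_mulEquiv.{u} {G H : Type u} [Group G] [Group H] (e : G ≃* H)
    (hG : IsSofic G) : IsSofic H := by
  obtain ⟨A, U, n, φ, hφ⟩ := hG
  exact ⟨A, U, n, φ.comp e.symm.toMonoidHom, hφ.comp e.symm.injective⟩

/-! ### Direct products -/

theorem ncard_prod_eq_sum {Q X : Type*} [Fintype Q] [Finite X] (S : Set (Q × X)) :
    S.ncard = ∑ q, {x | (q, x) ∈ S}.ncard := by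
  let e : S ≃ Σ q, {x | (q, x) ∈ S} :=
    { toFun := fun p => ⟨p.1.1, p.1.2, p.2⟩
      invFun := fun p => ⟨(p.1, p.2.1), p.2.2⟩
      left_inv := fun _ => rfl
      right_inv := fun _ => rfl }
  simp_rw [← Nat.card_coe_set_eq]
  rw [Nat.card_congr e, Nat.card_sigma]

/-- A subset of `Q × X` is small if, outside few exceptional `q : Q`, its fibres are small. -/
theorem ncard_prod_le {Q X : Type*} [Finite Q] [Finite X] (S : Set (Q × X)) (B : Set Q)
    {ε δ : ℝ} (hδ : 0 ≤ δ) (hB : (B.ncard : ℝ) ≤ ε * Nat.card Q)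
    (hS : ∀ q, q ∉ B → ({x | (q, x) ∈ S}.ncard : ℝ) ≤ δ * Nat.card X) :
    (S.ncard : ℝ) ≤ (ε + δ) * Nat.card (Q × X) := by
  classical
  have := Fintype.ofFinite Q
  rw [ncard_prod_eq_sum, Nat.cast_sum]
  have h (q : Q) : ({x | (q, x) ∈ S}.ncard : ℝ) ≤
      (if q ∈ B then (Nat.card X : ℝ) else 0) + δ * Nat.card X := by
    split_ifs with hq
    · have h1 : ({x | (q, x) ∈ S}.ncard : ℝ) ≤ Nat.card X := by
        exact_mod_cast Set.ncard_le_card _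
      have h2 : 0 ≤ δ * Nat.card X := by positivity
      linarith
    · simpa using hS q hq
  refine (Finset.sum_le_sum fun q _ => h q).trans ?_
  rw [Finset.sum_add_distrib, ← Finset.sum_filter, Finset.sum_const, Finset.sum_const,
    nsmul_eq_mul, nsmul_eq_mul, Finset.card_univ, ← Nat.card_eq_fintype_card, Nat.card_prod,
    Nat.cast_mul]
  have h3 : ((Finset.univ.filter (· ∈ B)).card : ℝ) ≤ ε * Nat.card Q := by
    refine le_trans (le_of_eq ?_) hB
    rw [Set.ncard_eq_toFinset_card']
    congr 2
    ext; simp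
  nlinarith [mul_le_mul_of_nonneg_right h3 (Nat.cast_nonneg (α := ℝ) (Nat.card X))]

theorem HasSoficApproximations.prod {G H : Type*} [Group G] [Group H]
    (hG : HasSoficApproximations G) (hH : HasSoficApproximations H) :
    HasSoficApproximations (G × H) := by
  classical
  refine HasSoficApproximations.of_fintype fun F ε hε => ?_
  obtain ⟨m, φ, hm, hφ1, hφ2⟩ := hG (F.image Prod.fst) (ε / 2) (half_pos hε)
  obtain ⟨n, ψ, hn, hψ1, hψ2⟩ := hH (F.image Prod.snd) (ε / 2) (half_pos hε)
  have h1 {p : G × H} (hp : p ∈ F) : p.1 ∈ F.image Prod.fst := Finset.mem_image_of_mem _ hp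
  have h2 {p : G × H} (hp : p ∈ F) : p.2 ∈ F.image Prod.snd := Finset.mem_image_of_mem _ hp
  have hε2 : (0 : ℝ) ≤ ε / 2 := by positivity
  refine ⟨Fin m × Fin n, inferInstance, fun p => (φ p.1).prodCongr (ψ p.2), ?_,
    fun g hg h hh => ?_, fun g hg hg1 => ?_⟩
  · rw [Nat.card_prod]
    simp [hm, hn]
  · rw [← add_halves ε]
    refine ncard_prod_le _ {x | φ (g.1 * h.1) x ≠ φ g.1 (φ h.1 x)} hε2
      (by simpa using hφ1 _ (h1 hg) _ (h1 hh)) fun q hq => ?_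
    simp only [Set.mem_ofPred_eq, not_not] at hq
    refine le_trans (le_of_eq ?_) (by simpa using hψ1 _ (h2 hg) _ (h2 hh))
    congr 2
    ext x
    simp [hq]
  · rw [← add_halves ε]
    by_cases h : g.1 = 1
    · have h' : g.2 ≠ 1 := fun h' => hg1 (Prod.ext h h')
      refine ncard_prod_le _ ∅ hε2 (by simp; positivity) fun q _ => ?_
      refine le_trans ?_ (by simpa using hψ2 _ (h2 hg) h')
      refine Nat.cast_le.mpr (Set.ncard_le_ncard fun x hx => ?_)
      exact congrArg Prod.snd hx
    · refine ncard_prod_le _ {x | φ g.1 x = x} hε2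
        (by simpa using hφ2 _ (h1 hg) h) fun q hq => ?_
      have : {x | (q, x) ∈ {x : Fin m × Fin n | ((φ g.1).prodCongr (ψ g.2)) x = x}} = ∅ := by
        ext x
        simpa using fun h1 _ => hq h1
      rw [this]
      simp
      positivity

/-! ### Extensions by amenable groups -/

open scoped Classical Pointwise in
theorem IsAmenable.exists_finset {Q : Type*} [Group Q] (hQ : IsAmenable Q) (S : Finset Q)
    {ε : ℝ} (hε : 0 < ε) : ∃ F : Finset Q, F.Nonempty ∧
      ∀ s ∈ S, ({q : F | s * q ∉ F}.ncard : ℝ) ≤ ε * Nat.card F := by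
  obtain ⟨F, hF, h⟩ := hQ S ε hε
  refine ⟨F, hF, fun s hs => le_trans ?_ ((h s hs).trans_eq (by simp))⟩
  refine Nat.cast_le.mpr ?_
  have hinj : Function.Injective fun q : F => s * (q : Q) := fun a b hab =>
    Subtype.ext (mul_left_cancel hab)
  rw [← Set.ncard_image_of_injective _ hinj, ← Set.ncard_coe_finset]
  refine Set.ncard_le_ncard ?_ (Finset.finite_toSet _)
  rintro _ ⟨q, hq, rfl⟩
  simp only [Finset.mem_coe, Finset.mem_symmDiff]
  exact Or.inl ⟨Finset.smul_mem_smul_finset q.2, hq⟩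

/-- Left multiplication by `s`, restricted to the points of `F` that it keeps in `F`, extends to
a permutation of `F`. -/
theorem Finset.exists_perm_mul_left {Q : Type*} [Group Q] (F : Finset Q) (s : Q) :
    ∃ p : Equiv.Perm F, ∀ q : F, s * (q : Q) ∈ F → (p q : Q) = s * q := by
  classical
  let e : {q : F // s * (q : Q) ∈ F} ≃ {q : F // s⁻¹ * (q : Q) ∈ F} :=
    { toFun := fun q => ⟨⟨s * q.1, q.2⟩, by simp⟩
      invFun := fun q => ⟨⟨s⁻¹ * q.1, q.2⟩, by simp⟩
      left_inv := fun q => by simp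
      right_inv := fun q => by simp }
  exact ⟨e.extendSubtype, fun q hq => congrArg Subtype.val (e.extendSubtype_apply_of_mem q hq)⟩

/-- Since `π` need not be onto, it may have no section. Writing `q` as `π (σ q)` times a
representative of its right coset of the range gives a substitute on all of `Q`, so Følner sets of
`Q` serve directly. -/
theorem MonoidHom.exists_equivariant_lift {G Q : Type*} [Group G] [Group Q] (π : G →* Q) :
    ∃ σ : Q → G, ∀ g q, π (σ (π g * q)) = π g * π (σ q) := by
  let r : Q → Q := fun q => (Quotient.mk (QuotientGroup.rightRel π.range) q).out
  have hr (g : G) (q : Q) : r (π g * q) = r q := by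
    refine congrArg Quotient.out (Quotient.sound ?_)
    refine QuotientGroup.rightRel_apply.mpr ⟨g⁻¹, ?_⟩
    simp
  have hσ (q : Q) : ∃ g : G, π g * r q = q := by
    obtain ⟨g, hg⟩ := QuotientGroup.rightRel_apply.mp
      (Quotient.mk_out (s := QuotientGroup.rightRel π.range) q)
    exact ⟨g, by rw [hg]; exact inv_mul_cancel_right _ _⟩
  choose σ hσ using hσ
  refine ⟨σ, fun g q => mul_right_cancel (b := r q) ?_⟩
  rw [mul_assoc, hσ, ← hr g q, hσ]

/-- A group with a homomorphism to an amenable group whose kernel is sofic is itself sofic. -/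
theorem HasSoficApproximations.of_ker {G Q : Type*} [Group G] [Group Q] (π : G →* Q)
    (hQ : IsAmenable Q) (hker : HasSoficApproximations π.ker) : HasSoficApproximations G := by
  classical
  obtain ⟨σ, hσ⟩ := π.exists_equivariant_lift
  have hc (g : G) (q : Q) : (σ (π g * q))⁻¹ * g * σ q ∈ π.ker := by
    rw [MonoidHom.mem_ker, map_mul, map_mul, map_inv, hσ]
    group
  -- The kernel-valued cocycle through which `G` acts as a skew product over `Q`.
  let c (g : G) (q : Q) : π.ker := ⟨_, hc g q⟩
  have hcmul (g h : G) (q : Q) : c (g * h) q = c g (π h * q) * c h q := by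
    ext
    simp only [c, map_mul, Subgroup.coe_mul, mul_assoc]
    group
  have hcne {g : G} (hg : π g = 1) (hg1 : g ≠ 1) (q : Q) : c g q ≠ 1 := by
    intro h
    have h' : (σ (π g * q))⁻¹ * g * σ q = 1 := congrArg Subtype.val h
    rw [hg, one_mul, mul_assoc, inv_mul_eq_one, right_eq_mul] at h'
    exact hg1 h'
  refine HasSoficApproximations.of_fintype fun F ε hε => ?_
  have hε3 : 0 < ε / 3 := by positivity
  -- Products are included because `p (π (g * h))` must be compared with `p (π g)` after `p (π h)`.
  obtain ⟨E, hE, hEF⟩ := hQ.exists_finset ((F ∪ Finset.image₂ (· * ·) F F).image π) hε3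
  choose p hp using fun s => E.exists_perm_mul_left s
  obtain ⟨n, ψ, hn, hψ1, hψ2⟩ := hker (Finset.image₂ c F E) _ hε3
  have hEF1 {g : G} (hg : g ∈ F) :
      ({q : E | π g * q ∉ E}.ncard : ℝ) ≤ ε / 3 * Nat.card E :=
    hEF _ (Finset.mem_image_of_mem _ (Finset.mem_union_left _ hg))
  have hEF2 {g h : G} (hg : g ∈ F) (hh : h ∈ F) :
      ({q : E | π (g * h) * q ∉ E}.ncard : ℝ) ≤ ε / 3 * Nat.card E :=
    hEF _ (Finset.mem_image_of_mem _
      (Finset.mem_union_right _ (Finset.mem_image₂_of_mem hg hh)))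
  let θ (g : G) : Equiv.Perm (E × Fin n) :=
    (Equiv.prodShear (p (π g)) fun q => ψ (c g q))
  have hθ (g : G) (q : E) (x : Fin n) : θ g (q, x) = (p (π g) q, ψ (c g q) x) := rfl
  refine ⟨E × Fin n, inferInstance, θ, ?_, fun g hg h hh => ?_, fun g hg hg1 => ?_⟩
  · rw [Nat.card_prod]
    simp [hn, hE]
  · have hB : (({q : E | π h * q ∉ E} ∪ {q : E | π (g * h) * q ∉ E}).ncard : ℝ) ≤
        (ε / 3 + ε / 3) * Nat.card E := by
      rw [add_mul]
      refine le_trans ?_ (add_le_add (hEF1 hh) (hEF2 hg hh))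
      exact_mod_cast Set.ncard_union_le _ _
    have h3 : ε = ε / 3 + ε / 3 + ε / 3 := by ring
    rw [h3]
    refine ncard_prod_le _ _ hε3.le hB fun q hq => ?_
    simp only [Set.mem_union, Set.mem_ofPred_eq, not_or, not_not] at hq
    obtain ⟨hq1, hq2⟩ := hq
    have hq3 : (p (π h) q : Q) = π h * q := hp _ _ hq1
    have hq4 : p (π (g * h)) q = p (π g) (p (π h) q) := by
      ext
      rw [hp _ _ hq2, hp _ _ (by rwa [hq3, ← mul_assoc, ← map_mul]), hq3, map_mul, mul_assoc]
    refine le_trans (le_of_eq ?_) ((hψ1 (c g (π h * q)) ?_ (c h q) ?_).trans_eq (by simp))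
    · congr 2
      ext x
      simp only [Set.mem_ofPred_eq, hθ, ne_eq, Prod.mk.injEq, hq4, true_and, hq3, hcmul]
    · exact Finset.mem_image₂_of_mem hg hq1
    · exact Finset.mem_image₂_of_mem hh q.2
  · have h3 : ε / 3 + ε / 3 ≤ ε := by linarith
    refine le_trans (ncard_prod_le _ _ hε3.le (hEF1 hg) fun q hq => ?_)
      (mul_le_mul_of_nonneg_right h3 (Nat.cast_nonneg _))
    simp only [Set.mem_ofPred_eq, not_not] at hq
    -- Kernel elements are moved in the fibres by `ψ`; all others already move the base point `q`.
    by_cases hπ : π g = 1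
    · refine le_trans ?_ ((hψ2 (c g q) (Finset.mem_image₂_of_mem hg
        q.2) (hcne hπ hg1 q)).trans_eq (by simp))
      refine Nat.cast_le.mpr (Set.ncard_le_ncard fun x hx => ?_)
      exact congrArg Prod.snd hx
    · have : {x | (q, x) ∈ {y : E × Fin n | θ g y = y}} = ∅ := by
        ext x
        simp only [Set.mem_ofPred_eq, hθ, Prod.mk.injEq, Set.mem_empty_iff_false, iff_false]
        rintro ⟨h1, -⟩
        have h2 := hp _ _ hq
        rw [h1, right_eq_mul] at h2
        exact hπ h2
      rw [this]
      simp
      positivity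

/-! ### Inner actions and the main theorem -/

theorem Subgroup.center_eq_bot_of_isSimpleGroup {N : Type*} [Group N] [IsSimpleGroup N]
    (h : ∃ x y : N, x * y ≠ y * x) : Subgroup.center N = ⊥ := by
  refine (Subgroup.Normal.eq_bot_or_eq_top inferInstance).resolve_right fun htop => ?_
  obtain ⟨x, y, hxy⟩ := h
  exact hxy (Subgroup.mem_center_iff.mp (htop ▸ Subgroup.mem_top y) x)

/-- If all elements of `G` act on the centreless normal subgroup `N` by inner automorphisms, then
`G` is the direct product of `N` and its centralizer. -/
theorem Subgroup.nonempty_mulEquiv_prod_centralizer {G : Type*} [Group G] (N : Subgroup G)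
    [N.Normal] (hN : Subgroup.center N = ⊥)
    (h : ∀ g : G, MulAut.conjNormal (H := N) g ∈ InnerAut N) :
    Nonempty (N × Subgroup.centralizer (N : Set G) ≃* G) := by
  have hcomm (x : N) (y : Subgroup.centralizer (N : Set G)) :
      Commute (N.subtype x) ((Subgroup.centralizer (N : Set G)).subtype y) :=
    Subgroup.mem_centralizer_iff.mp y.2 x x.2
  refine ⟨MulEquiv.ofBijective (MonoidHom.noncommCoprod _ _ hcomm) ⟨?_, fun g => ?_⟩⟩
  · rw [injective_iff_map_eq_one]
    rintro ⟨x, y⟩ hxy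
    have hxy' : (x : G) * y = 1 := hxy
    have hx : x ∈ Subgroup.center N := by
      refine Subgroup.mem_center_iff.mpr fun z => Subtype.ext ?_
      have hy := Subgroup.mem_centralizer_iff.mp (inv_mem y.2) z z.2
      rwa [← eq_inv_of_mul_eq_one_left hxy'] at hy
    rw [hN, Subgroup.mem_bot] at hx
    subst hx
    ext
    · rfl
    · simpa using hxy'
  · obtain ⟨x, hx⟩ := h g
    refine ⟨(x, ⟨(x : G)⁻¹ * g, Subgroup.mem_centralizer_iff.mpr fun z hz => ?_⟩),
      mul_inv_cancel_left _ _⟩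
    have h1 : (x : G) * z * (x : G)⁻¹ = g * z * g⁻¹ :=
      congrArg Subtype.val (DFunLike.congr_fun hx (⟨z, hz⟩ : N))
    calc z * ((x : G)⁻¹ * g) = (x : G)⁻¹ * (x * z * (x : G)⁻¹) * g := by group
      _ = (x : G)⁻¹ * g * z := by rw [h1]; group

theorem mainTheorem7 {G : Type*} [Group G] (hG : IsMinimalNonSofic G) :
    ¬ ∃ N : Subgroup G, N.Normal ∧ N ≠ ⊤ ∧ IsSimpleGroup N ∧ (∃ x y : N, x * y ≠ y * x) ∧
      IsAmenable (OuterAut N) := by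
  rintro ⟨N, _, hNtop, _, hnc, hout⟩
  obtain ⟨hns, hsub⟩ := hG
  let π : G →* OuterAut N := (QuotientGroup.mk' (InnerAut N)).comp MulAut.conjNormal
  by_cases hker : π.ker = ⊤
  · have hinner (g : G) : MulAut.conjNormal (H := N) g ∈ InnerAut N :=
      (QuotientGroup.eq_one_iff _).mp (hker.symm ▸ Subgroup.mem_top g : g ∈ π.ker)
    -- Otherwise `N` would be central, hence abelian.
    have hC : Subgroup.centralizer (N : Set G) ≠ ⊤ := by
      intro htop
      obtain ⟨x, y, hxy⟩ := hnc
      have hy : (y : G) ∈ Subgroup.centralizer (N : Set G) := htop ▸ Subgroup.mem_top _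
      exact hxy (Subtype.ext (Subgroup.mem_centralizer_iff.mp hy x x.2))
    obtain ⟨e⟩ := N.nonempty_mulEquiv_prod_centralizer
      (Subgroup.center_eq_bot_of_isSimpleGroup hnc) hinner
    exact hns (((hsub N hNtop).hasSoficApproximations.prod
      (hsub _ hC).hasSoficApproximations).isSofic.of_mulEquiv e)
  · exact hns (HasSoficApproximations.of_ker π hout (hsub _ hker).hasSoficApproximations).isSofic
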